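/- Consider a stochastic bandit with $K\ge 1$ arms; in each round the player plays one arm, and playing arm $i$ yields a fresh independent reward from a distribution with mean $\mu_i$ which is $1$-sub-Gaussian, i.e. $\mathbb{E}[e^{\lambda (Y-\mu_i)}]\le e^{\lambda^2/2}$ for all $\lambda\in\mathbb{R}$. For $\epsilon>0$ let $G$ be the graph on the arms in which distinct arms $i,j$ are adjacent iff $|\mu_i-\mu_j|<\epsilon$; $G$ is known to the player. Let $i_{\max}$, $i_{\min}$ be arms of largest and smallest mean, $\mathcal{A}$ the set of all arms of largest mean, $\Delta_i=\mu_{i_{\max}}-\mu_i$, and let $R(T)=\mathbb{E}\big[\sum_{t=1}^{T}(\mu_{i_{\max}}-X_{\pi_t}(t))\big]$ be the regret, where $\pi_t$ is the arm played in round $t$ and $X_{\pi_t}(t)$ the reward received. Arms $i,j$ are equivalent if they have the same closed neighborhood in $G$; $\mathcal{B}^*_i$ denotes the class of $i$. The candidate set $\mathcal{B}^*$ is the set of arms $i$ for which there are means $\mu'_1,\dots,\mu'_K$ defining the same graph $G$ (with the same $\epsilon$) and with $\mu'_i=\max_j\mu'_j$. The policy LSDT-CSI is as follows. (1) Offline elimination: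 perform a breadth-first search of $G$ from an arbitrary node and take the nodes of minimal degree in its last level; repeat this once from an arbitrary one of the nodes obtained; keep the union $B$ of the two sets. (2) Online aggregation: play each arm of $B$ once; afterwards, after $t$ rounds with $\tau_j(t)$ plays of arm $j$ and empirical average $\bar x_j(t)$, choose a class $S$ among the equivalence classes of the arms of $B$ maximizing $$\frac{\sum_{j\in S}\bar x_j(t)\tau_j(t)}{\sum_{j\in S}\tau_j(t)}+\sqrt{\frac{8\log t}{\sum_{j\in S}\tau_j(t)}}$$ and play in round $t+1$ an arm $j\in S$ maximizing $\bar x_j(t)+\sqrt{8\log t/\tau_j(t)}$. Ties are broken arbitrarily, without knowledge of future rewards. **Theorem.** There is a universal constant $C$ such that, whenever $G$ is connected, the regret of LSDT-CSI satisfies for all $T$ $$R(T)\le\Bigg(\frac{32\max_{i\in\mathcal{B}^*_{i_{\min}}}\Delta_i}{\big(\min_{j\in\mathcal{B}^*_{i_{\min}}}\Delta_j-\max_{k\in\mathcal{B}^*_{i_{\max}}}\Delta_k\big)^2}+\sum_{i\in\mathcal{B}^*_{i_{\max}}\setminus\mathcal{A}}\frac{32}{\Delta_i}\Bigg)\log T+C\Big(\max_{i\in\mathcal{B}^*_{i_{\min}}}\Delta_i\Big)|\mathcal{B}^*|,$$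 where the denominator of the first term is nonzero unless all means are equal; in that case the first term is read as $0$. For $T=0$, $\log T$ is read as $0$. Consequently, for fixed gaps the regret is $O\big((1+|\mathcal{B}^*_{i_{\max}}\setminus\mathcal{A}|)\log T\big)$ as $T\to\infty$, that is: for all $\delta,D>0$ there is a constant $C$, depending only on $\delta$ and $D$, such that if $G$ is connected, all $\Delta_i\le D$, $\Delta_i\ge\delta$ for all $i\in\mathcal{B}^*_{i_{\max}}\setminus\mathcal{A}$, and $|\min_{j\in\mathcal{B}^*_{i_{\min}}}\Delta_j-\max_{k\in\mathcal{B}^*_{i_{\max}}}\Delta_k|\ge\delta$ (the last condition being required only if not all means are equal), then $R(T)\le C(1+|\mathcal{B}^*_{i_{\max}}\setminus\mathcal{A}|)\log T$ for all sufficiently large $T$. -/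

import Mathlib

open MeasureTheory ProbabilityTheory Filter

namespace UnitIntervalBandit

noncomputable section

/-- Mean reward of each arm, where `ν i` is the reward distribution of arm `i`. -/
def mean {K : ℕ} (ν : Fin K → Measure ℝ) (i : Fin K) : ℝ := ∫ x, x ∂(ν i)

/-- The graph of similar arms: distinct arms are adjacent iff their means differ by less than `ε`. -/
def uig {K : ℕ} (ε : ℝ) (μ : Fin K → ℝ) : SimpleGraph (Fin K) where
  Adj i j := i ≠ j ∧ |μ i - μ j| < ε
  symm := ⟨fun _ _ h => ⟨h.1.symm, abs_sub_comm (μ _) (μ _) ▸ h.2⟩⟩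
  loopless := ⟨fun _ h => h.1 rfl⟩

/-- Closed neighborhood `N[i]`. -/
def closedNbhd {K : ℕ} (G : SimpleGraph (Fin K)) (i : Fin K) : Set (Fin K) :=
  insert i (G.neighborSet i)

open Classical in
/-- The neighborhood equivalence class of `i`: all `j` with `N[j] = N[i]`. -/
def eqClass {K : ℕ} (G : SimpleGraph (Fin K)) (i : Fin K) : Finset (Fin K) :=
  Finset.univ.filter fun j => closedNbhd G j = closedNbhd G i

theorem eqClass_nonempty {K : ℕ} (G : SimpleGraph (Fin K)) (i : Fin K) :
    (eqClass G i).Nonempty :=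
  ⟨i, by simp [eqClass]⟩

open Classical in
/-- The candidate set: the arms that are optimal under some assignment of means which conforms to
the graph of similar arms `uig ε μ`. -/
def candidateSet {K : ℕ} (ε : ℝ) (μ : Fin K → ℝ) : Finset (Fin K) :=
  Finset.univ.filter fun i => ∃ μ' : Fin K → ℝ, uig ε μ' = uig ε μ ∧ ∀ j, μ' j ≤ μ' i

open Classical in
/-- The last level of a breadth-first search of a connected graph from `i`:
the nodes at maximal distance from `i`. -/
def lastLevel {K : ℕ} (G : SimpleGraph (Fin K)) (i : Fin K) : Finset (Fin K) :=
  Finset.univ.filter fun j => ∀ k, G.dist i k ≤ G.dist i j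

open Classical in
/-- The nodes of minimal degree within the last level of a breadth-first search from `i`. -/
def bfsEnd {K : ℕ} (G : SimpleGraph (Fin K)) (i : Fin K) : Finset (Fin K) :=
  (lastLevel G i).filter fun j => ∀ k ∈ lastLevel G i, G.degree j ≤ G.degree k

/-- Possible outputs of offline elimination: one search from an arbitrary node `i`, a second one
from an arbitrary node `j` returned by the first; the returned nodes of both are collected. -/
def IsOfflineOutput {K : ℕ} (G : SimpleGraph (Fin K)) (B : Finset (Fin K)) : Prop :=
  ∃ i, ∃ j ∈ bfsEnd G i, B = bfsEnd G i ∪ bfsEnd G j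

/-! In what follows `a s` is the arm played in round `s + 1` and `x s` the reward received in that
round, so that the first `t` rounds are those with `s ∈ Finset.range t`. -/

/-- Number of plays of arm `i` in the first `t` rounds. -/
def pulls {K : ℕ} (a : ℕ → Fin K) (t : ℕ) (i : Fin K) : ℕ :=
  ((Finset.range t).filter fun s => a s = i).card

/-- Empirical average of the rewards from arm `i` in the first `t` rounds. -/
def empMean {K : ℕ} (a : ℕ → Fin K) (x : ℕ → ℝ) (t : ℕ) (i : Fin K) : ℝ :=
  (∑ s ∈ (Finset.range t).filter fun s => a s = i, x s) / (pulls a t i : ℝ)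

/-- The arm index `L_i(t)`. -/
def armIndex {K : ℕ} (a : ℕ → Fin K) (x : ℕ → ℝ) (t : ℕ) (i : Fin K) : ℝ :=
  empMean a x t i + √(8 * Real.log t / (pulls a t i : ℝ))

/-- The class index `H(t)` of a class `S` of arms. -/
def classIndex {K : ℕ} (a : ℕ → Fin K) (x : ℕ → ℝ) (t : ℕ) (S : Finset (Fin K)) : ℝ :=
  (∑ j ∈ S, empMean a x t j * (pulls a t j : ℝ)) / (∑ j ∈ S, (pulls a t j : ℝ))
    + √(8 * Real.log t / (∑ j ∈ S, (pulls a t j : ℝ)))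

/-- The plays `a` with rewards `x` follow the online step on the arm set `B`: every arm of `B` is
played once in the first `|B|` rounds, in any order; afterwards, given the indices after `t` rounds,
round `t + 1` plays an arm of maximal arm index inside a class of maximal class index. Ties are
broken arbitrarily. -/
structure FollowsOnline {K : ℕ} (G : SimpleGraph (Fin K)) (B : Finset (Fin K))
    (a : ℕ → Fin K) (x : ℕ → ℝ) : Prop where
  init : Set.BijOn a (Set.Iio B.card) B
  mem : ∀ t, B.card ≤ t → a t ∈ B
  class_max : ∀ t, B.card ≤ t → ∀ k ∈ B,
    classIndex a x t (eqClass G k) ≤ classIndex a x t (eqClass G (a t))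
  arm_max : ∀ t, B.card ≤ t → ∀ k ∈ eqClass G (a t),
    armIndex a x t k ≤ armIndex a x t (a t)

/-- The plays `a` with rewards `x` are a run of LSDT-CSI on the graph `G`. -/
def FollowsLSDTCSI {K : ℕ} (G : SimpleGraph (Fin K)) (a : ℕ → Fin K) (x : ℕ → ℝ) : Prop :=
  ∃ B, IsOfflineOutput G B ∧ FollowsOnline G B a x

/-- A stochastic bandit with reward distributions `ν`: `X t i` is the reward that arm `i` yields in
round `t + 1`, `π t` is the arm selected in that round, and `ℱ t` is the information available after
`t` rounds (rewards of these rounds, and possibly external randomness for breaking ties). -/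
structure IsBandit {K : ℕ} {Ω : Type*} {m : MeasurableSpace Ω} (ν : Fin K → Measure ℝ)
    (P : Measure Ω) (ℱ : Filtration ℕ m) (X : ℕ → Fin K → Ω → ℝ) (π : ℕ → Ω → Fin K) : Prop where
  reward_measurable : ∀ t i, Measurable[ℱ (t + 1)] (X t i)
  reward_law : ∀ t i, P.map (X t i) = ν i
  reward_indep : ∀ t i, Indep (MeasurableSpace.comap (X t i) inferInstance) (ℱ t) P
  choice_measurable : ∀ t, Measurable[ℱ t] (π t)

/-- The bandit is played according to LSDT-CSI, given complete side information. -/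
structure IsLSDTCSI {K : ℕ} {Ω : Type*} {m : MeasurableSpace Ω} (ε : ℝ) (ν : Fin K → Measure ℝ)
    (P : Measure Ω) (ℱ : Filtration ℕ m) (X : ℕ → Fin K → Ω → ℝ) (π : ℕ → Ω → Fin K) : Prop where
  bandit : IsBandit ν P ℱ X π
  follows : ∀ᵐ ω ∂P,
    FollowsLSDTCSI (uig ε (mean ν)) (fun t => π t ω) (fun t => X t (π t ω) ω)

/-- The gap of arm `i`, where `imax` is an optimal arm. -/
def gap {K : ℕ} (μ : Fin K → ℝ) (imax i : Fin K) : ℝ := μ imax - μ i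

/-- The regret after `T` rounds, where `imax` is an optimal arm. -/
def regret {K : ℕ} {Ω : Type*} {_ : MeasurableSpace Ω} (ν : Fin K → Measure ℝ) (P : Measure Ω)
    (X : ℕ → Fin K → Ω → ℝ) (π : ℕ → Ω → Fin K) (imax : Fin K) (T : ℕ) : ℝ :=
  ∫ ω, (∑ _t ∈ Finset.range T, mean ν imax - ∑ t ∈ Finset.range T, X t (π t ω) ω) ∂P

/-- Largest gap in the class of arm `i`. -/
def maxGap {K : ℕ} (ε : ℝ) (μ : Fin K → ℝ) (imax i : Fin K) : ℝ :=
  (eqClass (uig ε μ) i).sup' (eqClass_nonempty _ _) (gap μ imax)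

/-- Smallest gap in the class of arm `i`. -/
def minGap {K : ℕ} (ε : ℝ) (μ : Fin K → ℝ) (imax i : Fin K) : ℝ :=
  (eqClass (uig ε μ) i).inf' (eqClass_nonempty _ _) (gap μ imax)

open Classical in
/-- The suboptimal arms in the class of the optimal arm `imax`. -/
def suboptTop {K : ℕ} (ε : ℝ) (μ : Fin K → ℝ) (imax : Fin K) : Finset (Fin K) :=
  (eqClass (uig ε μ) imax).filter fun i => ¬ ∀ j, μ j ≤ μ i

end

end UnitIntervalBandit

open UnitIntervalBandit

/-!
The regret of LSDT-CSI is governed by two facts: offline elimination leaves only the two extreme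
classes, and pooled averages concentrate as well as averages of a single arm.

*Graph.* Walks in the graph cannot jump over an arm, so distances from a root are monotone in the
mean on either side of it (`dist_le_dist_of_between`). The arms of the last level above the root
therefore form a clique with `imax`, and their closed neighborhoods contain that of `imax`; so
minimal degree singles out the class `A` of `imax`, and by reflection the class `Z` of `imin` below
the root. A search that misses the top ends in `Z`, from where the second search reaches `imax`
(`IsOfflineOutput.subset_and_mem`). Both classes consist of candidates, and either the graph is
complete and `A = Z`, or all means in `Z` are smaller than those in `A` (`complete_or_separated`).

*Concentration.* For a set `S` of arms let `n` be its number of plays and `M` the sum of its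
centered rewards after `t` rounds. Independence of the rewards from the past makes
`exp (l * M - l ^ 2 * n / 2)` a supermartingale (`IsBandit.lintegral_prod_expWeight_le`). Markov's
inequality and a union bound over the `t` possible values of `n` show that the pooled average leaves
its confidence interval with probability at most `2 / t ^ 3`
(`IsBandit.measureReal_deviates_le` keeps the summable bound `2 / t ^ 2`).

*Counting.* The arm index is the class index of a singleton. If both confidence bounds hold, a set
`S'` whose means lie below those of `S` by a margin `δ` can have the larger index only while it has
been played at most `32 log T / δ ^ 2` times (`classIndex_lt_classIndex`), so its expected number of
plays is `32 log T / δ ^ 2 + O(1)` (`IsBandit.sum_measureReal_le`). This is applied to each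
suboptimal arm of `A` against `imax`, and to `Z` against `A`; it remains to weigh the plays by the
gaps (`IsBandit.regret_eq`).
-/

namespace UnitIntervalBandit

/-! ### The offline step: unit interval graphs and breadth-first search -/

section Graph

variable {K : ℕ} {ε : ℝ} {μ : Fin K → ℝ}

theorem uig_neg (ε : ℝ) (μ : Fin K → ℝ) : uig ε (-μ) = uig ε μ := by
  ext i j
  have : |(-μ) i - (-μ) j| = |μ i - μ j| := by
    rw [Pi.neg_apply, Pi.neg_apply, abs_sub_comm]; congr 1; ring
  simp only [uig, this]

theorem mem_closedNbhd_uig (hε : 0 < ε) {i j : Fin K} :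
    j ∈ closedNbhd (uig ε μ) i ↔ |μ i - μ j| < ε := by
  simp only [closedNbhd, Set.mem_insert_iff, SimpleGraph.mem_neighborSet, uig]
  constructor
  · rintro (rfl | h)
    · simpa using hε
    · exact h.2
  · intro h
    by_cases hij : j = i
    · exact Or.inl hij
    · exact Or.inr ⟨fun e => hij e.symm, h⟩

theorem mem_eqClass {G : SimpleGraph (Fin K)} {i j : Fin K} :
    j ∈ eqClass G i ↔ closedNbhd G j = closedNbhd G i := by
  simp [eqClass]

theorem self_mem_eqClass (G : SimpleGraph (Fin K)) (i : Fin K) : i ∈ eqClass G i :=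
  mem_eqClass.2 rfl

theorem eqClass_eq_of_mem {G : SimpleGraph (Fin K)} {i j : Fin K} (h : j ∈ eqClass G i) :
    eqClass G j = eqClass G i := by
  ext k
  rw [mem_eqClass, mem_eqClass, mem_eqClass.1 h]

open Classical in
theorem ncard_closedNbhd (G : SimpleGraph (Fin K)) (i : Fin K) :
    (closedNbhd G i).ncard = G.degree i + 1 := by
  rw [closedNbhd, Set.ncard_insert_of_notMem (by simp), Set.ncard_eq_toFinset_card',
    ← SimpleGraph.card_neighborFinset_eq_degree, SimpleGraph.neighborFinset_def]

open Classical in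
theorem degree_le_of_closedNbhd_subset {G : SimpleGraph (Fin K)} {i j : Fin K}
    (h : closedNbhd G i ⊆ closedNbhd G j) : G.degree i ≤ G.degree j := by
  have := Set.ncard_le_ncard h (Set.toFinite _)
  rw [ncard_closedNbhd, ncard_closedNbhd] at this
  omega

open Classical in
theorem closedNbhd_eq_of_subset_of_degree_le {G : SimpleGraph (Fin K)} {i j : Fin K}
    (h : closedNbhd G i ⊆ closedNbhd G j) (hd : G.degree j ≤ G.degree i) :
    closedNbhd G j = closedNbhd G i := by
  refine (Set.eq_of_subset_of_ncard_le h ?_ (Set.toFinite _)).symm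
  rw [ncard_closedNbhd, ncard_closedNbhd]
  omega

open Classical in
theorem mem_bfsEnd {G : SimpleGraph (Fin K)} {i j : Fin K} :
    j ∈ bfsEnd G i ↔
      j ∈ lastLevel G i ∧ ∀ k ∈ lastLevel G i, G.degree j ≤ G.degree k := by
  rw [bfsEnd, Finset.mem_filter]

theorem mem_lastLevel {G : SimpleGraph (Fin K)} {i j : Fin K} :
    j ∈ lastLevel G i ↔ ∀ k, G.dist i k ≤ G.dist i j := by
  simp [lastLevel]

theorem dist_le_one_of_mem_closedNbhd {G : SimpleGraph (Fin K)} {i j : Fin K}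
    (h : j ∈ closedNbhd G i) : G.dist i j ≤ 1 := by
  rcases h with rfl | h
  · simp
  · exact (SimpleGraph.dist_eq_one_iff_adj.2 h).le

theorem mem_closedNbhd_of_dist_le_one {G : SimpleGraph (Fin K)} (hG : G.Connected) {i j : Fin K}
    (h : G.dist i j ≤ 1) : j ∈ closedNbhd G i := by
  by_cases hij : j = i
  · exact Or.inl hij
  · have := hG.pos_dist_of_ne (Ne.symm hij)
    exact Or.inr (SimpleGraph.dist_eq_one_iff_adj.1 (by omega))

/-- Walks cannot jump over an arm: a nontrivial walk from `i` upwards to `w` passes within one step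
of every arm whose mean lies in between. -/
theorem dist_le_length_of_between (hε : 0 < ε) (hG : (uig ε μ).Connected) {i v : Fin K}
    (hiv : μ i ≤ μ v) {w : Fin K} (p : (uig ε μ).Walk w i) (hp : 1 ≤ p.length)
    (hvw : μ v ≤ μ w) : (uig ε μ).dist i v ≤ p.length := by
  induction p with
  | nil => simp at hp
  | @cons w q i h p ih =>
    rw [SimpleGraph.Walk.length_cons]
    have hwq := abs_lt.1 h.2
    rcases lt_or_ge (μ q) (μ v) with hq | hq
    · have hadj : (uig ε μ).dist q v ≤ 1 := by
        apply dist_le_one_of_mem_closedNbhd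
        rw [mem_closedNbhd_uig hε, abs_lt]
        constructor <;> linarith
      calc (uig ε μ).dist i v ≤ (uig ε μ).dist i q + (uig ε μ).dist q v := hG.dist_triangle
        _ ≤ p.length + 1 := by
          gcongr
          rw [SimpleGraph.dist_comm]
          exact SimpleGraph.dist_le p
    · rcases Nat.eq_zero_or_pos p.length with h0 | h0
      · obtain rfl := SimpleGraph.Walk.eq_of_length_eq_zero h0
        have : (uig ε μ).dist q v ≤ 1 := by
          apply dist_le_one_of_mem_closedNbhd
          rw [mem_closedNbhd_uig hε, abs_lt]
          constructor <;> linarith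
        omega
      · exact (ih hiv h0 hq).trans (Nat.le_succ _)

theorem dist_le_dist_of_between (hε : 0 < ε) (hG : (uig ε μ).Connected) {i v w : Fin K}
    (hiv : μ i ≤ μ v) (hvw : μ v ≤ μ w) (hw : w ≠ i) :
    (uig ε μ).dist i v ≤ (uig ε μ).dist i w := by
  obtain ⟨p, hp⟩ := hG.exists_walk_length_eq_dist w i
  have := hG.pos_dist_of_ne hw
  rw [(uig ε μ).dist_comm (u := i) (v := w), ← hp]
  exact dist_le_length_of_between hε hG hiv p (by omega) hvw

/-- The part of the last level above the root is a clique with the top arm `m`, whose closed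
neighborhood is therefore the smallest there. -/
theorem closedNbhd_subset_of_mem_lastLevel (hε : 0 < ε) (hG : (uig ε μ).Connected)
    {i m v : Fin K} (hm : ∀ j, μ j ≤ μ m) (hv : v ∈ lastLevel (uig ε μ) i) (hiv : μ i ≤ μ v) :
    closedNbhd (uig ε μ) m ⊆ closedNbhd (uig ε μ) v := by
  have key : μ m - μ v < ε := by
    by_cases hmi : m = i
    · subst hmi; linarith
    obtain ⟨p, hp⟩ := hG.exists_walk_length_eq_dist m i
    cases p with
    | nil => exact absurd rfl hmi
    | @cons _ q _ h p =>
      rw [SimpleGraph.Walk.length_cons] at hp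
      have hmq := abs_lt.1 h.2
      have hle := mem_lastLevel.1 hv m
      rw [(uig ε μ).dist_comm (u := i) (v := m)] at hle
      rcases lt_or_ge (μ q) (μ v) with hq | hq
      · linarith
      · rcases Nat.eq_zero_or_pos p.length with h0 | h0
        · obtain rfl := SimpleGraph.Walk.eq_of_length_eq_zero h0
          linarith
        · have := dist_le_length_of_between hε hG hiv p h0 hq
          omega
  intro u hu
  rw [mem_closedNbhd_uig hε, abs_lt] at hu ⊢
  have := hm v
  have := hm u
  constructor <;> linarith

theorem mem_eqClass_of_mem_bfsEnd_of_le (hε : 0 < ε) (hG : (uig ε μ).Connected)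
    {i m v : Fin K} (hm : ∀ j, μ j ≤ μ m) (hv : v ∈ bfsEnd (uig ε μ) i) (hiv : μ i ≤ μ v) :
    v ∈ eqClass (uig ε μ) m := by
  classical
  rw [mem_bfsEnd] at hv
  rw [mem_eqClass]
  by_cases hmi : m = i
  · subst hmi
    ext u
    rw [mem_closedNbhd_uig hε, mem_closedNbhd_uig hε, le_antisymm (hm v) hiv]
  · refine closedNbhd_eq_of_subset_of_degree_le
      (closedNbhd_subset_of_mem_lastLevel hε hG hm hv.1 hiv) (hv.2 m ?_)
    rw [mem_lastLevel]
    exact fun k => (mem_lastLevel.1 hv.1 k).trans (dist_le_dist_of_between hε hG hiv (hm v) hmi)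

/-- A search ends in the classes of the two extreme arms. -/
theorem bfsEnd_subset (hε : 0 < ε) (hG : (uig ε μ).Connected) {imax imin : Fin K}
    (hmax : ∀ j, μ j ≤ μ imax) (hmin : ∀ j, μ imin ≤ μ j) (i : Fin K) :
    bfsEnd (uig ε μ) i ⊆ eqClass (uig ε μ) imax ∪ eqClass (uig ε μ) imin := by
  intro v hv
  rw [Finset.mem_union]
  rcases le_total (μ i) (μ v) with h | h
  · exact Or.inl (mem_eqClass_of_mem_bfsEnd_of_le hε hG hmax hv h)
  · -- reflecting the means turns the bottom of the order into its top
    rw [← uig_neg] at hv hG ⊢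
    exact Or.inr (mem_eqClass_of_mem_bfsEnd_of_le hε hG (fun j => neg_le_neg (hmin j)) hv
      (neg_le_neg h))

theorem closedNbhd_eq_univ_of_lt (hε : 0 < ε) {imax imin : Fin K}
    (hmax : ∀ j, μ j ≤ μ imax) (hmin : ∀ j, μ imin ≤ μ j) (h : μ imax - μ imin < ε) (k : Fin K) :
    closedNbhd (uig ε μ) k = Set.univ := by
  refine Set.eq_univ_of_forall fun u => ?_
  rw [mem_closedNbhd_uig hε, abs_lt]
  have := hmax k; have := hmax u; have := hmin k; have := hmin u
  constructor <;> linarith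

/-- A search that starts in the bottom class returns the top arm. -/
theorem imax_mem_bfsEnd_of_mem_eqClass (hε : 0 < ε) (hG : (uig ε μ).Connected) {imax imin : Fin K}
    (hmax : ∀ j, μ j ≤ μ imax) (hmin : ∀ j, μ imin ≤ μ j) {j : Fin K}
    (hj : j ∈ eqClass (uig ε μ) imin) (hne : j ≠ imax) : imax ∈ bfsEnd (uig ε μ) j := by
  classical
  rw [mem_eqClass] at hj
  have hpos := hG.pos_dist_of_ne hne
  -- arms below `j` are neighbors of `j`
  have hlow : ∀ k, μ k < μ j → (uig ε μ).dist j k ≤ 1 := by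
    intro k hk
    apply dist_le_one_of_mem_closedNbhd
    have h : imin ∈ closedNbhd (uig ε μ) j := hj ▸ Set.mem_insert _ _
    rw [mem_closedNbhd_uig hε, abs_lt] at h ⊢
    have := hmin k
    constructor <;> linarith
  rw [mem_bfsEnd]
  constructor
  · rw [mem_lastLevel]
    intro k
    rcases lt_or_ge (μ k) (μ j) with hk | hk
    · exact (hlow k hk).trans hpos
    · exact dist_le_dist_of_between hε hG hk (hmax k) hne.symm
  · intro k hk
    apply degree_le_of_closedNbhd_subset
    rcases lt_or_ge (μ k) (μ j) with hkj | hkj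
    · have h1 := mem_closedNbhd_of_dist_le_one hG
        ((mem_lastLevel.1 hk imax).trans (hlow k hkj))
      rw [hj, mem_closedNbhd_uig hε, abs_sub_comm, abs_lt] at h1
      rw [closedNbhd_eq_univ_of_lt hε hmax hmin h1.2 k]
      exact Set.subset_univ _
    · exact closedNbhd_subset_of_mem_lastLevel hε hG hmax hk hkj

/-- Offline elimination keeps only arms of the two extreme classes, and it keeps every optimal arm,
since a search that misses the top class ends in the bottom class. -/
theorem IsOfflineOutput.subset_and_mem (hε : 0 < ε) (hG : (uig ε μ).Connected)
    {imax imin : Fin K} (hmax : ∀ j, μ j ≤ μ imax) (hmin : ∀ j, μ imin ≤ μ j)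
    {B : Finset (Fin K)} (hB : IsOfflineOutput (uig ε μ) B) :
    B ⊆ eqClass (uig ε μ) imax ∪ eqClass (uig ε μ) imin ∧ imax ∈ B := by
  classical
  obtain ⟨i, j, hj, rfl⟩ := hB
  refine ⟨Finset.union_subset (bfsEnd_subset hε hG hmax hmin i) (bfsEnd_subset hε hG hmax hmin j),
    ?_⟩
  rw [Finset.mem_union]
  by_cases hjm : j = imax
  · exact Or.inl (hjm ▸ hj)
  rcases Finset.mem_union.1 (bfsEnd_subset hε hG hmax hmin i hj) with hA | hZ
  · rw [mem_eqClass] at hA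
    have hj' := mem_bfsEnd.1 hj
    by_cases hi : i = imax
    · -- the root is a twin of `j`, so the last level is level one and the graph is complete
      subst hi
      right
      have hjN : j ∈ closedNbhd (uig ε μ) i := hA ▸ Set.mem_insert _ _
      have h1 := mem_closedNbhd_of_dist_le_one hG
        ((mem_lastLevel.1 hj'.1 imin).trans (dist_le_one_of_mem_closedNbhd hjN))
      rw [mem_closedNbhd_uig hε, abs_lt] at h1
      have huniv := closedNbhd_eq_univ_of_lt hε hmax hmin h1.2
      exact imax_mem_bfsEnd_of_mem_eqClass hε hG hmax hmin
        (mem_eqClass.2 ((huniv _).trans (huniv _).symm)) hjm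
    · left
      rw [mem_bfsEnd]
      refine ⟨?_, fun k hk => (degree_le_of_closedNbhd_subset hA.ge).trans (hj'.2 k hk)⟩
      rw [mem_lastLevel]
      intro k
      refine (mem_lastLevel.1 hj'.1 k).trans ?_
      rcases le_total (μ i) (μ j) with h | h
      · exact dist_le_dist_of_between hε hG h (hmax j) (Ne.symm hi)
      · have hpos := hG.pos_dist_of_ne hi
        refine le_trans (dist_le_one_of_mem_closedNbhd ?_) hpos
        have h1 : imax ∈ closedNbhd (uig ε μ) j := hA ▸ Set.mem_insert _ _
        rw [mem_closedNbhd_uig hε, abs_lt] at h1 ⊢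
        have := hmax i
        constructor <;> linarith
  · exact Or.inr (imax_mem_bfsEnd_of_mem_eqClass hε hG hmax hmin hZ hjm)

/-- A twin of the top arm may be moved to the top without changing the graph. -/
theorem eqClass_imax_subset_candidateSet (hε : 0 < ε) {imax : Fin K} (hmax : ∀ j, μ j ≤ μ imax) :
    eqClass (uig ε μ) imax ⊆ candidateSet ε μ := by
  intro i hi
  rw [mem_eqClass] at hi
  have key : ∀ b, |μ imax - μ b| < ε ↔ |μ i - μ b| < ε := fun b => by
    rw [← mem_closedNbhd_uig hε, ← mem_closedNbhd_uig hε, hi]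
  simp only [candidateSet, Finset.mem_filter, Finset.mem_univ, true_and]
  refine ⟨Function.update μ i (μ imax), ?_, fun j => ?_⟩
  · ext a b
    simp only [uig]
    refine and_congr_right fun hab => ?_
    by_cases ha : a = i
    · subst ha
      rw [Function.update_self, Function.update_of_ne hab.symm]
      exact key b
    · by_cases hb : b = i
      · subst hb
        rw [Function.update_self, Function.update_of_ne hab, abs_sub_comm, abs_sub_comm (μ a)]
        exact key a
      · rw [Function.update_of_ne ha, Function.update_of_ne hb]
  · rw [Function.update_self]
    by_cases hj : j = i
    · subst hj; rw [Function.update_self]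
    · rw [Function.update_of_ne hj]; exact hmax j

theorem eqClass_imin_subset_candidateSet (hε : 0 < ε) {imin : Fin K} (hmin : ∀ j, μ imin ≤ μ j) :
    eqClass (uig ε μ) imin ⊆ candidateSet ε μ := by
  intro i hi
  have h := eqClass_imax_subset_candidateSet (μ := -μ) hε (fun j => neg_le_neg (hmin j))
    ((uig_neg ε μ).symm ▸ hi)
  simpa [candidateSet, uig_neg] using h

/-- Either the graph is complete, or every mean of the bottom class lies below every mean of the
top class. -/
theorem complete_or_separated (hε : 0 < ε) {imax imin : Fin K}
    (hmax : ∀ j, μ j ≤ μ imax) (hmin : ∀ j, μ imin ≤ μ j) :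
    (∀ i j, j ∈ eqClass (uig ε μ) i) ∨
      ∀ j ∈ eqClass (uig ε μ) imin, ∀ k ∈ eqClass (uig ε μ) imax, μ j < μ k := by
  rcases lt_or_ge (μ imax - μ imin) ε with h | h
  · left
    have huniv := closedNbhd_eq_univ_of_lt hε hmax hmin h
    exact fun i j => mem_eqClass.2 ((huniv _).trans (huniv _).symm)
  · right
    intro j hj k hk
    rw [mem_eqClass] at hj hk
    have h1 : imin ∈ closedNbhd (uig ε μ) j := hj ▸ Set.mem_insert _ _
    have h2 : imin ∉ closedNbhd (uig ε μ) k := by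
      rw [hk, mem_closedNbhd_uig hε, not_lt]
      exact h.trans (le_abs_self _)
    rw [mem_closedNbhd_uig hε, abs_lt] at h1
    rw [mem_closedNbhd_uig hε, not_lt, abs_of_nonneg (by linarith [hmin k])] at h2
    linarith

end Graph

/-! ### Pooled statistics of a set of arms -/

section Path

variable {K : ℕ}

/-- Number of plays of arms of `S` in the first `t` rounds. -/
def setPulls (a : ℕ → Fin K) (t : ℕ) (S : Finset (Fin K)) : ℕ :=
  ((Finset.range t).filter fun s => a s ∈ S).card

/-- Sum of the centered rewards received from arms of `S` in the first `t` rounds; each reward is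
centered at the mean of the arm that produced it. -/
noncomputable def noise (μ : Fin K → ℝ) (a : ℕ → Fin K) (x : ℕ → ℝ) (t : ℕ)
    (S : Finset (Fin K)) : ℝ :=
  ∑ s ∈ (Finset.range t).filter fun s => a s ∈ S, (x s - μ (a s))

/-- After `t` rounds, `S` has been played and its pooled empirical average is off by at least the
confidence radius `√(8 log t / n)`, where `n` is the number of plays of `S`. -/
def Deviates (μ : Fin K → ℝ) (a : ℕ → Fin K) (x : ℕ → ℝ) (t : ℕ) (S : Finset (Fin K)) : Prop :=
  0 < setPulls a t S ∧ √(8 * setPulls a t S * Real.log t) ≤ |noise μ a x t S|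

variable {μ : Fin K → ℝ} {a : ℕ → Fin K} {x : ℕ → ℝ} {t : ℕ} {S S' : Finset (Fin K)}

theorem setPulls_succ : setPulls a (t + 1) S = setPulls a t S + if a t ∈ S then 1 else 0 := by
  rw [setPulls, setPulls, Finset.range_add_one, Finset.filter_insert]
  split_ifs
  · rw [Finset.card_insert_of_notMem (by simp)]
  · simp

theorem noise_succ :
    noise μ a x (t + 1) S = noise μ a x t S + if a t ∈ S then x t - μ (a t) else 0 := by
  rw [noise, noise, Finset.sum_filter, Finset.sum_filter, Finset.sum_range_succ]

theorem setPulls_mono : Monotone fun t => setPulls a t S :=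
  monotone_nat_of_le_succ fun t => by simp only [setPulls_succ]; omega

theorem setPulls_le : setPulls a t S ≤ t :=
  (Finset.card_filter_le _ _).trans (Finset.card_range t).le

theorem setPulls_pos {s : ℕ} (hs : s < t) (h : a s ∈ S) : 0 < setPulls a t S :=
  Finset.card_pos.2 ⟨s, Finset.mem_filter.2 ⟨Finset.mem_range.2 hs, h⟩⟩

theorem sum_filter_fiberwise (f : ℕ → ℝ) :
    ∑ j ∈ S, ∑ s ∈ (Finset.range t).filter (fun s => a s = j), f s =
      ∑ s ∈ (Finset.range t).filter (fun s => a s ∈ S), f s := by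
  rw [← Finset.sum_fiberwise_of_maps_to (t := S) (g := a)
    (fun s hs => (Finset.mem_filter.1 hs).2)]
  refine Finset.sum_congr rfl fun j hj => Finset.sum_congr ?_ fun _ _ => rfl
  ext s
  simp only [Finset.mem_filter, and_assoc]
  constructor
  · rintro ⟨h, rfl⟩; exact ⟨h, hj, rfl⟩
  · rintro ⟨h, -, h'⟩; exact ⟨h, h'⟩

theorem sum_pulls : ∑ j ∈ S, (pulls a t j : ℝ) = setPulls a t S := by
  have := sum_filter_fiberwise (S := S) (a := a) (t := t) fun _ => 1
  simpa [pulls, setPulls] using this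

theorem empMean_mul_pulls (j : Fin K) :
    empMean a x t j * pulls a t j = ∑ s ∈ (Finset.range t).filter (fun s => a s = j), x s := by
  rw [empMean]
  by_cases h : (pulls a t j : ℝ) = 0
  · have h' : (Finset.range t).filter (fun s => a s = j) = ∅ := by
      rw [← Finset.card_eq_zero]; exact_mod_cast h
    rw [h, h', mul_zero, Finset.sum_empty]
  · exact div_mul_cancel₀ _ h

theorem classIndex_eq : classIndex a x t S =
    (∑ s ∈ (Finset.range t).filter (fun s => a s ∈ S), x s) / setPulls a t S
      + √(8 * Real.log t / setPulls a t S) := by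
  rw [classIndex, sum_pulls, ← sum_filter_fiberwise]
  simp only [empMean_mul_pulls]

/-- The arm index is the class index of a singleton, so that both levels of the policy are governed
by the same estimates. -/
theorem armIndex_eq_classIndex (i : Fin K) : armIndex a x t i = classIndex a x t {i} := by
  rw [classIndex_eq, armIndex, empMean]
  simp [pulls, setPulls]

theorem sqrt_radius {n L : ℝ} (hn : 0 < n) : √(8 * L / n) = √(8 * n * L) / n := by
  rw [show 8 * L / n = 8 * n * L / n ^ 2 by field_simp, Real.sqrt_div' _ (sq_nonneg n),
    Real.sqrt_sq hn.le]

/-- Pooled averages lie between the extreme means of the pool, up to noise. So, if the confidence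
bounds hold and `S'` has been played often enough, a pool `S'` of worse arms has a smaller index
than the pool `S`. -/
theorem classIndex_lt_classIndex {lo hi : ℝ} (hlo : ∀ j ∈ S, lo ≤ μ j) (hhi : ∀ j ∈ S', μ j ≤ hi)
    (hlt : hi < lo) (h0 : 0 < setPulls a t S)
    (hn : 32 * Real.log t / (lo - hi) ^ 2 < setPulls a t S')
    (hS : ¬ Deviates μ a x t S) (hS' : ¬ Deviates μ a x t S') :
    classIndex a x t S' < classIndex a x t S := by
  have hL : 0 ≤ Real.log t := Real.log_natCast_nonneg t
  have hδ : 0 < (lo - hi) ^ 2 := pow_pos (sub_pos.2 hlt) 2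
  have h0' : 0 < setPulls a t S' := by
    have : (0 : ℝ) < setPulls a t S' := lt_of_le_of_lt (by positivity) hn
    exact_mod_cast this
  have d := abs_lt.1 (not_le.1 fun h => hS ⟨h0, h⟩)
  have d' := abs_lt.1 (not_le.1 fun h => hS' ⟨h0', h⟩)
  have e : (setPulls a t S : ℝ) * lo + noise μ a x t S ≤
      ∑ s ∈ (Finset.range t).filter (fun s => a s ∈ S), x s := by
    rw [noise, setPulls, ← nsmul_eq_mul, ← Finset.sum_const, ← Finset.sum_add_distrib]
    refine Finset.sum_le_sum fun s hs => ?_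
    have := hlo _ (Finset.mem_filter.1 hs).2
    linarith
  have e' : ∑ s ∈ (Finset.range t).filter (fun s => a s ∈ S'), x s ≤
      (setPulls a t S' : ℝ) * hi + noise μ a x t S' := by
    rw [noise, setPulls, ← nsmul_eq_mul, ← Finset.sum_const, ← Finset.sum_add_distrib]
    refine Finset.sum_le_sum fun s hs => ?_
    have := hhi _ (Finset.mem_filter.1 hs).2
    linarith
  have h1 : (0 : ℝ) < setPulls a t S := by exact_mod_cast h0
  have h1' : (0 : ℝ) < setPulls a t S' := by exact_mod_cast h0'
  rw [classIndex_eq, classIndex_eq, sqrt_radius h1, sqrt_radius h1', ← add_div, ← add_div]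
  have hr : 2 * √(8 * setPulls a t S' * Real.log t) ≤ setPulls a t S' * (lo - hi) := by
    rw [← le_div_iff₀' two_pos]
    refine Real.sqrt_le_iff.2 ⟨by have := sub_pos.2 hlt; positivity, ?_⟩
    have := mul_le_mul_of_nonneg_left ((div_lt_iff₀ hδ).1 hn).le h1'.le
    nlinarith
  calc _ < lo := by rw [div_lt_iff₀ h1']; linarith
    _ < _ := by rw [lt_div_iff₀ h1]; linarith

/-- Each play of `S` increases its count, so few plays happen while the count is small. -/
theorem card_filter_setPulls_le {u : ℝ} (hu : 0 ≤ u) (s : Finset ℕ) :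
    ((s.filter fun t => a t ∈ S ∧ (setPulls a t S : ℝ) ≤ u).card : ℝ) ≤ u + 1 := by
  have h : (s.filter fun t => a t ∈ S ∧ (setPulls a t S : ℝ) ≤ u).card ≤
      (Finset.range (⌊u⌋₊ + 1)).card := by
    refine Finset.card_le_card_of_injOn (fun t => setPulls a t S) (fun t ht => ?_)
      fun t ht t' ht' htt => ?_
    · have := (Finset.mem_filter.1 ht).2.2
      simpa [Nat.lt_succ_iff] using Nat.le_floor this
    · have key : ∀ t t' : ℕ, a t ∈ S → t < t' → setPulls a t S < setPulls a t' S := by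
        intro t t' h htt
        have h1 := setPulls_mono (a := a) (S := S) (Nat.succ_le_of_lt htt)
        simp only [Nat.succ_eq_add_one, setPulls_succ, if_pos h] at h1
        omega
      have h1 := (Finset.mem_filter.1 ht).2.1
      have h2 := (Finset.mem_filter.1 ht').2.1
      simp only at htt
      rcases lt_trichotomy t t' with h | h | h
      · have := key _ _ h1 h; omega
      · exact h
      · have := key _ _ h2 h; omega
  rw [Finset.card_range] at h
  calc _ ≤ ((⌊u⌋₊ + 1 : ℕ) : ℝ) := by exact_mod_cast h
    _ ≤ u + 1 := by push_cast; linarith [Nat.floor_le hu]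

end Path

/-! ### Concentration of pooled averages -/

section Prob

variable {K : ℕ} {Ω : Type*} {m : MeasurableSpace Ω} {ν : Fin K → Measure ℝ}
  {P : Measure Ω} {ℱ : Filtration ℕ m} {X : ℕ → Fin K → Ω → ℝ} {π : ℕ → Ω → Fin K}

theorem measurable_apply_choice {m' : MeasurableSpace Ω} {β : Type*} [MeasurableSpace β]
    {c : Ω → Fin K} {Y : Fin K → Ω → β} (hc : Measurable c) (hY : ∀ i, Measurable (Y i)) :
    Measurable fun ω => Y (c ω) ω := by
  intro s hs
  have : (fun ω => Y (c ω) ω) ⁻¹' s = ⋃ i, c ⁻¹' {i} ∩ Y i ⁻¹' s := by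
    ext ω; simp
  rw [this]
  exact MeasurableSet.iUnion fun i => (hc (measurableSet_singleton i)).inter (hY i hs)

/-- The factor by which a reward `y` of arm `i` changes the exponential supermartingale of the set
`S` with parameter `l`. -/
noncomputable def expWeight (μ : Fin K → ℝ) (S : Finset (Fin K)) (l : ℝ) (i : Fin K) (y : ℝ) :
    ENNReal :=
  if i ∈ S then ENNReal.ofReal (Real.exp (l * (y - μ i) - l ^ 2 / 2)) else 1

theorem measurable_expWeight (μ : Fin K → ℝ) (S : Finset (Fin K)) (l : ℝ) (i : Fin K) :
    Measurable (expWeight μ S l i) := by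
  unfold expWeight
  split_ifs <;> fun_prop

theorem prod_expWeight (μ : Fin K → ℝ) (S : Finset (Fin K)) (l : ℝ) (a : ℕ → Fin K) (x : ℕ → ℝ)
    (t : ℕ) : ∏ s ∈ Finset.range t, expWeight μ S l (a s) (x s) =
      ENNReal.ofReal (Real.exp (l * noise μ a x t S - l ^ 2 / 2 * setPulls a t S)) := by
  induction t with
  | zero => simp [noise, setPulls]
  | succ t ih =>
    rw [Finset.prod_range_succ, ih, noise_succ, setPulls_succ, expWeight]
    split_ifs
    · rw [← ENNReal.ofReal_mul (Real.exp_nonneg _), ← Real.exp_add]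
      congr 2; push_cast; ring
    · simp

theorem lintegral_expWeight_le [∀ i, IsProbabilityMeasure (ν i)]
    (hν : ∀ i, HasSubgaussianMGF (fun x => x - mean ν i) 1 (ν i)) (S : Finset (Fin K)) (l : ℝ)
    (i : Fin K) : ∫⁻ y, expWeight (mean ν) S l i y ∂(ν i) ≤ 1 := by
  unfold expWeight
  split_ifs
  · have h1 : ∀ y, Real.exp (l * (y - mean ν i) - l ^ 2 / 2) =
        Real.exp (-(l ^ 2 / 2)) * Real.exp (l * (y - mean ν i)) := fun y => by
      rw [← Real.exp_add]; ring_nf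
    simp only [h1]
    rw [← ofReal_integral_eq_lintegral_ofReal (((hν i).integrable_exp_mul l).const_mul _)
      (ae_of_all _ fun y => by positivity), integral_const_mul, ENNReal.ofReal_le_one]
    have h2 := (hν i).mgf_le l
    rw [mgf] at h2
    calc _ ≤ Real.exp (-(l ^ 2 / 2)) * Real.exp ((1 : NNReal) * l ^ 2 / 2) := by gcongr
      _ = 1 := by rw [← Real.exp_add]; simp
  · simp

theorem IsBandit.measurable_reward (h : IsBandit ν P ℱ X π) (s : ℕ) :
    Measurable[ℱ (s + 1)] fun ω => X s (π s ω) ω :=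
  measurable_apply_choice (m' := ℱ (s + 1))
    ((h.choice_measurable s).mono (ℱ.mono (Nat.le_succ s)) le_rfl) (h.reward_measurable s)

theorem IsBandit.measurable_prod_expWeight (h : IsBandit ν P ℱ X π) (S : Finset (Fin K)) (l : ℝ)
    (t : ℕ) : Measurable[ℱ t] fun ω =>
      ∏ s ∈ Finset.range t, expWeight (mean ν) S l (π s ω) (X s (π s ω) ω) := by
  refine Finset.measurable_fun_prod _ fun s hs => ?_
  have hst : s + 1 ≤ t := Finset.mem_range.1 hs
  exact measurable_apply_choice (m' := ℱ t)
    ((h.choice_measurable s).mono (ℱ.mono (by omega)) le_rfl)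
    fun i => (measurable_expWeight _ S l i).comp ((h.measurable_reward s).mono (ℱ.mono hst) le_rfl)

/-- The exponential supermartingale of a set of arms, for adaptively chosen plays. -/
theorem IsBandit.lintegral_prod_expWeight_le [∀ i, IsProbabilityMeasure (ν i)]
    [IsProbabilityMeasure P] (h : IsBandit ν P ℱ X π)
    (hν : ∀ i, HasSubgaussianMGF (fun x => x - mean ν i) 1 (ν i)) (S : Finset (Fin K)) (l : ℝ)
    (t : ℕ) : ∫⁻ ω, ∏ s ∈ Finset.range t,
      expWeight (mean ν) S l (π s ω) (X s (π s ω) ω) ∂P ≤ 1 := by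
  induction t with
  | zero => simp
  | succ t ih =>
    set W : Ω → ENNReal := fun ω =>
      ∏ s ∈ Finset.range t, expWeight (mean ν) S l (π s ω) (X s (π s ω) ω) with hW
    have hWm : Measurable[ℱ t] W := h.measurable_prod_expWeight S l t
    have hset : ∀ i, MeasurableSet[ℱ t] (π t ⁻¹' {i}) := fun i =>
      h.choice_measurable t (measurableSet_singleton i)
    have hfm : ∀ i, Measurable[ℱ t] ((π t ⁻¹' {i}).indicator W) := fun i => hWm.indicator (hset i)
    have hXm : ∀ i, Measurable (X t i) := fun i => (h.reward_measurable t i).mono (ℱ.le _) le_rfl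
    have hgm : ∀ i, Measurable fun ω => expWeight (mean ν) S l i (X t i ω) := fun i =>
      (measurable_expWeight _ S l i).comp (hXm i)
    have hsplit : ∀ ω, ∏ s ∈ Finset.range (t + 1),
        expWeight (mean ν) S l (π s ω) (X s (π s ω) ω) =
        ∑ i, (π t ⁻¹' {i}).indicator W ω * expWeight (mean ν) S l i (X t i ω) := by
      intro ω
      rw [Finset.prod_range_succ, Finset.sum_eq_single (π t ω)]
      · simp [W]
      · intro i _ hi
        rw [Set.indicator_of_notMem (by simpa using hi.symm), zero_mul]
      · simp
    have hsum : ∀ ω, W ω = ∑ i, (π t ⁻¹' {i}).indicator W ω := by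
      intro ω
      rw [Finset.sum_eq_single (π t ω)]
      · simp
      · intro i _ hi
        rw [Set.indicator_of_notMem (by simpa using hi.symm)]
      · simp
    calc _ = ∑ i, ∫⁻ ω, (π t ⁻¹' {i}).indicator W ω * expWeight (mean ν) S l i (X t i ω) ∂P := by
          simp only [hsplit]
          exact lintegral_finsetSum _ fun i _ =>
            ((hfm i).mono (ℱ.le t) le_rfl).mul (hgm i)
      _ = ∑ i, (∫⁻ ω, (π t ⁻¹' {i}).indicator W ω ∂P) *
            ∫⁻ ω, expWeight (mean ν) S l i (X t i ω) ∂P := by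
          refine Finset.sum_congr rfl fun i _ => ?_
          exact lintegral_mul_eq_lintegral_mul_lintegral_of_independent_measurableSpace (ℱ.le t)
            (hXm i).comap_le (h.reward_indep t i).symm (hfm i)
            ((measurable_expWeight _ S l i).comp (comap_measurable (X t i)))
      _ ≤ ∑ i, ∫⁻ ω, (π t ⁻¹' {i}).indicator W ω ∂P := by
          refine Finset.sum_le_sum fun i _ => mul_le_of_le_one_right' ?_
          rw [← lintegral_map (measurable_expWeight _ S l i) (hXm i), h.reward_law]
          exact lintegral_expWeight_le hν S l i
      _ = ∫⁻ ω, W ω ∂P := by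
          rw [← lintegral_finsetSum _ fun i _ => (hfm i).mono (ℱ.le t) le_rfl]
          simp only [← hsum]
      _ ≤ 1 := ih

/-- One-sided deviation at a fixed number `n` of plays; the sign is carried by `σ`. -/
theorem IsBandit.measure_deviation_le [∀ i, IsProbabilityMeasure (ν i)]
    [IsProbabilityMeasure P] (h : IsBandit ν P ℱ X π)
    (hν : ∀ i, HasSubgaussianMGF (fun x => x - mean ν i) 1 (ν i)) (S : Finset (Fin K))
    {σ : ℝ} (hσ : σ ^ 2 = 1) {t n : ℕ} (ht : 1 ≤ t) (hn : 1 ≤ n) :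
    P {ω | setPulls (fun s => π s ω) t S = n ∧ √(8 * n * Real.log t) ≤
      σ * noise (mean ν) (fun s => π s ω) (fun s => X s (π s ω) ω) t S} ≤
      ENNReal.ofReal (1 / (t : ℝ) ^ 4) := by
  have hL : 0 ≤ Real.log t := Real.log_natCast_nonneg t
  have ht' : (0 : ℝ) < t := by exact_mod_cast ht
  have hn' : (0 : ℝ) < n := by exact_mod_cast hn
  -- this parameter minimizes the exponential bound
  set r := √(8 * n * Real.log t) / n with hr
  have hr0 : 0 ≤ r := by positivity
  have hrn : r * √(8 * n * Real.log t) = 8 * Real.log t := by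
    rw [hr, div_mul_eq_mul_div, Real.mul_self_sqrt (by positivity)]; field_simp
  have hr2 : r ^ 2 * n = 8 * Real.log t := by
    rw [hr, div_pow, Real.sq_sqrt (by positivity)]; field_simp
  have hpos : (0 : ℝ) < (t : ℝ) ^ 4 := by positivity
  calc _ ≤ P {ω | ENNReal.ofReal ((t : ℝ) ^ 4) ≤ ∏ s ∈ Finset.range t,
            expWeight (mean ν) S (σ * r) (π s ω) (X s (π s ω) ω)} := by
        refine measure_mono ?_
        rintro ω ⟨h1, h2⟩
        simp only [Set.mem_ofPred_eq]
        rw [prod_expWeight _ _ _ (fun s => π s ω) (fun s => X s (π s ω) ω), h1]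
        apply ENNReal.ofReal_le_ofReal
        rw [← Real.exp_log hpos, Real.exp_le_exp, Real.log_pow, mul_pow, hσ, one_mul]
        have := mul_le_mul_of_nonneg_left h2 hr0
        rw [hrn] at this
        push_cast
        linarith
    _ ≤ (∫⁻ ω, ∏ s ∈ Finset.range t,
            expWeight (mean ν) S (σ * r) (π s ω) (X s (π s ω) ω) ∂P) /
          ENNReal.ofReal ((t : ℝ) ^ 4) :=
        meas_ge_le_lintegral_div
          ((h.measurable_prod_expWeight S _ t).mono (ℱ.le t) le_rfl).aemeasurable
          (ENNReal.ofReal_pos.2 hpos).ne' ENNReal.ofReal_ne_top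
    _ ≤ 1 / ENNReal.ofReal ((t : ℝ) ^ 4) := by
        gcongr
        exact h.lintegral_prod_expWeight_le hν S _ t
    _ = _ := by rw [ENNReal.ofReal_div_of_pos hpos, ENNReal.ofReal_one]

theorem IsBandit.measureReal_deviates_le [∀ i, IsProbabilityMeasure (ν i)]
    [IsProbabilityMeasure P] (h : IsBandit ν P ℱ X π)
    (hν : ∀ i, HasSubgaussianMGF (fun x => x - mean ν i) 1 (ν i)) (S : Finset (Fin K))
    {t : ℕ} (ht : 1 ≤ t) :
    P.real {ω | Deviates (mean ν) (fun s => π s ω) (fun s => X s (π s ω) ω) t S} ≤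
      2 * ((t : ℝ) ^ 2)⁻¹ := by
  have ht' : (1 : ℝ) ≤ t := by exact_mod_cast ht
  set E : ℝ → ℕ → Set Ω := fun σ n => {ω | setPulls (fun s => π s ω) t S = n ∧
    √(8 * n * Real.log t) ≤ σ * noise (mean ν) (fun s => π s ω) (fun s => X s (π s ω) ω) t S}
    with hE
  have hEle : ∀ σ : ℝ, σ ^ 2 = 1 → ∀ n ∈ Finset.Icc 1 t, P.real (E σ n) ≤ 1 / (t : ℝ) ^ 4 :=
    fun σ hσ n hn => ENNReal.toReal_le_of_le_ofReal (by positivity)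
      (h.measure_deviation_le hν S hσ ht (Finset.mem_Icc.1 hn).1)
  calc _ ≤ P.real (⋃ n ∈ Finset.Icc 1 t, (E 1 n ∪ E (-1) n)) := by
        refine measureReal_mono (fun ω hω => ?_) (measure_ne_top _ _)
        simp only [Set.mem_iUnion]
        refine ⟨_, Finset.mem_Icc.2 ⟨hω.1, setPulls_le⟩, ?_⟩
        rcases le_abs.1 hω.2 with h1 | h1
        · exact Or.inl ⟨rfl, by simpa using h1⟩
        · exact Or.inr ⟨rfl, by simpa using h1⟩
    _ ≤ ∑ n ∈ Finset.Icc 1 t, P.real (E 1 n ∪ E (-1) n) := measureReal_biUnion_finset_le _ _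
    _ ≤ ∑ n ∈ Finset.Icc 1 t, (1 / (t : ℝ) ^ 4 + 1 / (t : ℝ) ^ 4) := by
        refine Finset.sum_le_sum fun n hn => (measureReal_union_le _ _).trans ?_
        exact add_le_add (hEle 1 (by norm_num) n hn) (hEle (-1) (by norm_num) n hn)
    _ = 2 * ((t : ℝ) ^ 3)⁻¹ := by
        rw [Finset.sum_const, Nat.card_Icc, nsmul_eq_mul]
        simp only [Nat.add_sub_cancel]
        field_simp
        ring
    _ ≤ _ := by gcongr; norm_num

theorem measurable_setPulls (h : IsBandit ν P ℱ X π) (S : Finset (Fin K)) (t : ℕ) :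
    Measurable fun ω => setPulls (fun s => π s ω) t S := by
  simp only [setPulls, Finset.card_filter]
  refine Finset.measurable_fun_sum _ fun s _ => ?_
  exact (Measurable.of_discrete (f := fun i : Fin K => if i ∈ S then 1 else 0)).comp
    ((h.choice_measurable s).mono (ℱ.le s) le_rfl)

/-- Expected number of plays of a set `S'` whose arms are all worse than those of `S`, over rounds
in which playing `S'` requires its index to be at least that of `S`. -/
theorem IsBandit.sum_measureReal_le [∀ i, IsProbabilityMeasure (ν i)]
    [IsProbabilityMeasure P] (h : IsBandit ν P ℱ X π)
    (hν : ∀ i, HasSubgaussianMGF (fun x => x - mean ν i) 1 (ν i)) {S S' : Finset (Fin K)}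
    {lo hi : ℝ} (hlo : ∀ j ∈ S, lo ≤ mean ν j) (hhi : ∀ j ∈ S', mean ν j ≤ hi) (hlt : hi < lo)
    {N : ℕ} (hN : 1 ≤ N)
    (hplay : ∀ᵐ ω ∂P, ∀ t, N ≤ t → π t ω ∈ S' → 0 < setPulls (fun s => π s ω) t S ∧
      classIndex (fun s => π s ω) (fun s => X s (π s ω) ω) t S ≤
        classIndex (fun s => π s ω) (fun s => X s (π s ω) ω) t S') (T : ℕ) :
    ∑ t ∈ Finset.Ico N T, P.real {ω | π t ω ∈ S'} ≤
      32 / (lo - hi) ^ 2 * Real.log T + 9 := by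
  have hL : 0 ≤ Real.log T := Real.log_natCast_nonneg T
  set u := 32 / (lo - hi) ^ 2 * Real.log T with hu
  have hu0 : 0 ≤ u := by positivity
  set F : ℕ → Set Ω := fun t => {ω | π t ω ∈ S' ∧ (setPulls (fun s => π s ω) t S' : ℝ) ≤ u}
    with hF
  set D : Finset (Fin K) → ℕ → Set Ω := fun R t =>
    {ω | Deviates (mean ν) (fun s => π s ω) (fun s => X s (π s ω) ω) t R} with hD
  have hFm : ∀ t, MeasurableSet (F t) := fun t =>
    (((h.choice_measurable t).mono (ℱ.le t) le_rfl) (Finset.measurableSet S')).inter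
      ((measurable_setPulls h S' t) (Set.to_countable {n : ℕ | (n : ℝ) ≤ u}).measurableSet)
  have hround : ∀ t ∈ Finset.Ico N T, P.real {ω | π t ω ∈ S'} ≤
      P.real (F t) + 4 * ((t : ℝ) ^ 2)⁻¹ := by
    intro t ht
    obtain ⟨hNt, htT⟩ := Finset.mem_Ico.1 ht
    have ht1 : 1 ≤ t := hN.trans hNt
    have hsub : P.real {ω | π t ω ∈ S'} ≤ P.real (F t ∪ (D S t ∪ D S' t)) := by
      refine ENNReal.toReal_mono (measure_ne_top _ _) (measure_mono_ae ?_)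
      filter_upwards [hplay] with ω hω hmem
      obtain ⟨h0, hle⟩ := hω t hNt hmem
      by_contra hcon
      have hcon' := not_or.1 hcon
      have hcon2 := not_or.1 hcon'.2
      refine absurd hle (not_le.2 ?_)
      refine classIndex_lt_classIndex hlo hhi hlt h0 (lt_of_le_of_lt ?_
        (not_le.1 fun hle' => hcon'.1 ⟨hmem, hle'⟩)) hcon2.1 hcon2.2
      rw [hu, div_mul_eq_mul_div]
      gcongr
    have h1 := measureReal_union_le (μ := P) (F t) (D S t ∪ D S' t)
    have h2 := measureReal_union_le (μ := P) (D S t) (D S' t)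
    have h3 := h.measureReal_deviates_le hν S ht1
    have h4 := h.measureReal_deviates_le hν S' ht1
    linarith
  have hcount : ∑ t ∈ Finset.Ico N T, P.real (F t) ≤ u + 1 := by
    have hint : ∀ t ∈ Finset.Ico N T, Integrable ((F t).indicator fun _ => (1 : ℝ)) P :=
      fun t _ => (integrable_const _).indicator (hFm t)
    calc _ = ∫ ω, ∑ t ∈ Finset.Ico N T, (F t).indicator (fun _ => (1 : ℝ)) ω ∂P := by
          rw [integral_finsetSum _ hint]
          refine Finset.sum_congr rfl fun t _ => ?_
          rw [integral_indicator_const _ (hFm t), smul_eq_mul, mul_one]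
      _ ≤ ∫ _, (u + 1) ∂P := by
          refine integral_mono (integrable_finsetSum _ hint) (integrable_const _) fun ω => ?_
          classical
          have := card_filter_setPulls_le (a := fun s => π s ω) (S := S') hu0 (Finset.Ico N T)
          refine le_trans (le_of_eq ?_) this
          rw [Finset.card_filter, Nat.cast_sum]
          refine Finset.sum_congr rfl fun t _ => ?_
          simp only [Set.indicator_apply, hF, Set.mem_ofPred_eq]
          split_ifs <;> simp
      _ = u + 1 := by simp
  have hseries : ∑ t ∈ Finset.Ico N T, ((t : ℝ) ^ 2)⁻¹ ≤ 2 := by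
    refine le_trans (Finset.sum_le_sum_of_subset_of_nonneg ?_ fun _ _ _ => by positivity)
      ((sum_Ioo_inv_sq_le 0 T).trans (by norm_num))
    intro t ht
    rw [Finset.mem_Ico] at ht
    exact Finset.mem_Ioo.2 ⟨by omega, ht.2⟩
  calc _ ≤ ∑ t ∈ Finset.Ico N T, (P.real (F t) + 4 * ((t : ℝ) ^ 2)⁻¹) := Finset.sum_le_sum hround
    _ ≤ u + 9 := by rw [Finset.sum_add_distrib, ← Finset.mul_sum]; linarith

/-! ### Decomposition of the regret -/

theorem integrable_id_of_subgaussian {ρ : Measure ℝ} [IsProbabilityMeasure ρ] {c : ℝ}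
    (hρ : HasSubgaussianMGF (fun x => x - c) 1 ρ) : Integrable (fun x : ℝ => x) ρ := by
  refine (hρ.integrable.add (integrable_const c)).congr (ae_of_all _ fun x => ?_)
  simp

/-- Since a reward is independent of the choice of the arm, the regret counts the gaps of the arms
played. -/
theorem IsBandit.regret_eq [∀ i, IsProbabilityMeasure (ν i)]
    [IsProbabilityMeasure P] (h : IsBandit ν P ℱ X π)
    (hν : ∀ i, HasSubgaussianMGF (fun x => x - mean ν i) 1 (ν i)) (imax : Fin K) (T : ℕ) :
    regret ν P X π imax T = ∑ t ∈ Finset.range T, ∫ ω, gap (mean ν) imax (π t ω) ∂P := by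
  have hXm : ∀ t i, Measurable (X t i) := fun t i =>
    (h.reward_measurable t i).mono (ℱ.le _) le_rfl
  have hXint : ∀ t i, Integrable (X t i) P := by
    intro t i
    have h1 := integrable_id_of_subgaussian (hν i)
    rw [← h.reward_law t i] at h1
    exact h1.comp_measurable (hXm t i)
  have hXmean : ∀ t i, ∫ ω, X t i ω ∂P = mean ν i := by
    intro t i
    rw [mean, ← h.reward_law t i, integral_map (hXm t i).aemeasurable (by fun_prop)]
  have hset : ∀ t i, MeasurableSet[ℱ t] (π t ⁻¹' {i}) := fun t i =>
    h.choice_measurable t (measurableSet_singleton i)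
  have hsplit : ∀ (t : ℕ) (Y : Fin K → Ω → ℝ) (ω : Ω),
      Y (π t ω) ω = ∑ i, (π t ⁻¹' {i}).indicator (fun _ => (1 : ℝ)) ω * Y i ω := by
    intro t Y ω
    rw [Finset.sum_eq_single (π t ω)]
    · simp
    · intro i _ hi
      rw [Set.indicator_of_notMem (by simpa using hi.symm), zero_mul]
    · simp
  have hind : ∀ t i, IndepFun ((π t ⁻¹' {i}).indicator (fun _ => (1 : ℝ))) (X t i) P := by
    intro t i
    refine indep_of_indep_of_le_left (h.reward_indep t i).symm ?_
    exact Measurable.comap_le ((@measurable_const _ _ _ (ℱ t) _).indicator (hset t i))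
  have hindInt : ∀ t i, Integrable ((π t ⁻¹' {i}).indicator (fun _ => (1 : ℝ))) P := fun t i =>
    (integrable_const _).indicator (ℱ.le t _ (hset t i))
  have hint : ∀ t i, Integrable (fun ω =>
      (π t ⁻¹' {i}).indicator (fun _ => (1 : ℝ)) ω * X t i ω) P := fun t i =>
    (hind t i).integrable_mul (hindInt t i) (hXint t i)
  have hYint : ∀ t, Integrable (fun ω => X t (π t ω) ω) P := by
    intro t
    simp only [hsplit t (X t)]
    exact integrable_finsetSum _ fun i _ => hint t i
  have hround : ∀ t, ∫ ω, X t (π t ω) ω ∂P = ∫ ω, mean ν (π t ω) ∂P := by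
    intro t
    simp only [hsplit t (X t), hsplit t fun i _ => mean ν i]
    rw [integral_finsetSum _ fun i _ => hint t i,
      integral_finsetSum _ fun i _ => (hindInt t i).mul_const _]
    refine Finset.sum_congr rfl fun i _ => ?_
    rw [integral_mul_const, ← hXmean t i]
    exact (hind t i).integral_fun_mul_eq_mul_integral (hindInt t i).aestronglyMeasurable
      (hXint t i).aestronglyMeasurable
  have hmint : ∀ t, Integrable (fun ω => mean ν (π t ω)) P := by
    intro t
    simp only [hsplit t fun i _ => mean ν i]
    exact integrable_finsetSum _ fun i _ => (hindInt t i).mul_const _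
  simp only [regret, gap, ← Finset.sum_sub_distrib]
  have hdiff : ∀ t ∈ Finset.range T, Integrable (fun ω => mean ν imax - X t (π t ω) ω) P :=
    fun t _ => (integrable_const _).sub (hYint t)
  rw [integral_finsetSum _ hdiff]
  refine Finset.sum_congr rfl fun t _ => ?_
  rw [integral_sub (integrable_const _) (hYint t), integral_sub (integrable_const _) (hmint t),
    hround]

end Prob

/-! ### The regret bound -/

section Regret

variable {K : ℕ}

theorem gap_le_maxGap {ε : ℝ} {μ : Fin K → ℝ} {imax i j : Fin K} (h : j ∈ eqClass (uig ε μ) i) :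
    gap μ imax j ≤ maxGap ε μ imax i :=
  Finset.le_sup' (gap μ imax) h

theorem minGap_le_gap {ε : ℝ} {μ : Fin K → ℝ} {imax i j : Fin K} (h : j ∈ eqClass (uig ε μ) i) :
    minGap ε μ imax i ≤ gap μ imax j :=
  Finset.inf'_le (gap μ imax) h

theorem maxGap_lt_minGap {ε : ℝ} {μ : Fin K → ℝ} {imax imin : Fin K}
    (h : ∀ j ∈ eqClass (uig ε μ) imin, ∀ k ∈ eqClass (uig ε μ) imax, μ j < μ k) :
    maxGap ε μ imax imax < minGap ε μ imax imin := by
  rw [maxGap, minGap, Finset.sup'_lt_iff]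
  intro k hk
  rw [Finset.lt_inf'_iff]
  exact fun j hj => sub_lt_sub_left (h j hj k hk) _

theorem minGap_sub_maxGap_ne_zero {ε : ℝ} {μ : Fin K → ℝ} (hε : 0 < ε) {imax imin : Fin K}
    (hmax : ∀ j, μ j ≤ μ imax) (hmin : ∀ j, μ imin ≤ μ j) (hpos : ∃ i, 0 < gap μ imax i) :
    minGap ε μ imax imin - maxGap ε μ imax imax ≠ 0 := by
  rcases complete_or_separated (ε := ε) hε hmax hmin with h | h
  · obtain ⟨i, hi⟩ := hpos
    have h1 := minGap_le_gap (imax := imax) (h imin imax)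
    have h2 := gap_le_maxGap (imax := imax) (h imax i)
    rw [gap, sub_self] at h1
    linarith
  · exact (sub_pos.2 (maxGap_lt_minGap h)).ne'

/-- What the policy guarantees once the initial round-robin is over for certain, whichever output
`B` the offline step has produced. -/
theorem FollowsLSDTCSI.after_init {ε : ℝ} {μ : Fin K → ℝ} (hε : 0 < ε)
    (hG : (uig ε μ).Connected) {imax imin : Fin K} (hmax : ∀ j, μ j ≤ μ imax)
    (hmin : ∀ j, μ imin ≤ μ j) {a : ℕ → Fin K} {x : ℕ → ℝ} (h : FollowsLSDTCSI (uig ε μ) a x)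
    {t : ℕ} (ht : (eqClass (uig ε μ) imax ∪ eqClass (uig ε μ) imin).card ≤ t) :
    a t ∈ eqClass (uig ε μ) imax ∪ eqClass (uig ε μ) imin ∧
      (∀ S, imax ∈ S → 0 < setPulls a t S) ∧
      (a t ∈ eqClass (uig ε μ) imax → armIndex a x t imax ≤ armIndex a x t (a t)) ∧
      (a t ∈ eqClass (uig ε μ) imin →
        classIndex a x t (eqClass (uig ε μ) imax) ≤
          classIndex a x t (eqClass (uig ε μ) imin)) := by
  obtain ⟨B, hB, hf⟩ := h
  obtain ⟨hsub, hmem⟩ := hB.subset_and_mem hε hG hmax hmin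
  have hBt : B.card ≤ t := (Finset.card_le_card hsub).trans ht
  refine ⟨hsub (hf.mem t hBt), fun S hS => ?_, fun hA => ?_, fun hZ => ?_⟩
  · obtain ⟨s, hs, hsa⟩ := hf.init.surjOn hmem
    exact setPulls_pos (lt_of_lt_of_le hs hBt) (hsa ▸ hS)
  · refine hf.arm_max t hBt imax ?_
    rw [eqClass_eq_of_mem hA]
    exact self_mem_eqClass _ _
  · have := hf.class_max t hBt imax hmem
    rwa [eqClass_eq_of_mem hZ] at this

variable {Ω : Type*} {m : MeasurableSpace Ω} {ν : Fin K → Measure ℝ}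
  {P : Measure Ω} {ℱ : Filtration ℕ m} {X : ℕ → Fin K → Ω → ℝ} {π : ℕ → Ω → Fin K}

/-- Rounds `t < |A ∪ Z|`, where `A` and `Z` are the classes of `imax` and `imin`, contain the initial
round-robin for every possible output of the offline step and cost at most the largest gap each.
Later rounds play a suboptimal arm of `A`, which has to beat the index of `imax`, or the class `Z`,
which has to beat the index of `A`. -/
theorem IsLSDTCSI.regret_le {ε : ℝ} (hε : 0 < ε) [∀ i, IsProbabilityMeasure (ν i)]
    [IsProbabilityMeasure P] (h : IsLSDTCSI ε ν P ℱ X π)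
    (hν : ∀ i, HasSubgaussianMGF (fun x => x - mean ν i) 1 (ν i))
    (hG : (uig ε (mean ν)).Connected) {imax imin : Fin K}
    (hmax : ∀ i, mean ν i ≤ mean ν imax) (hmin : ∀ i, mean ν imin ≤ mean ν i) (T : ℕ) :
    regret ν P X π imax T ≤
      (32 * maxGap ε (mean ν) imax imin
          / (minGap ε (mean ν) imax imin - maxGap ε (mean ν) imax imax) ^ 2
        + ∑ i ∈ suboptTop ε (mean ν) imax, 32 / gap (mean ν) imax i) * Real.log T
      + 19 * maxGap ε (mean ν) imax imin * ((candidateSet ε (mean ν)).card : ℝ) := by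
  classical
  set μ := mean ν with hμ
  set A := eqClass (uig ε μ) imax
  set Z := eqClass (uig ε μ) imin
  set g := maxGap ε μ imax imin
  set d := minGap ε μ imax imin - maxGap ε μ imax imax with hd
  set N := (A ∪ Z).card
  have hL : 0 ≤ Real.log T := Real.log_natCast_nonneg T
  have hN1 : 1 ≤ N := Finset.card_pos.2 ⟨imax, Finset.mem_union_left _ (self_mem_eqClass _ _)⟩
  have hgap : ∀ i, gap μ imax i ≤ g := fun i =>
    (sub_le_sub_left (hmin i) _).trans (gap_le_maxGap (self_mem_eqClass _ imin))
  have hgap0 : ∀ i, 0 ≤ gap μ imax i := fun i => sub_nonneg.2 (hmax i)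
  have hg0 : 0 ≤ g := (hgap0 imax).trans (hgap imax)
  have hcand : A ∪ Z ⊆ candidateSet ε μ := Finset.union_subset
    (eqClass_imax_subset_candidateSet hε hmax) (eqClass_imin_subset_candidateSet hε hmin)
  have hsubA : suboptTop ε μ imax ⊆ A := Finset.filter_subset _ _
  have hsub_pos : ∀ i ∈ suboptTop ε μ imax, 0 < gap μ imax i := by
    intro i hi
    obtain ⟨j, hj⟩ := not_forall.1 (Finset.mem_filter.1 hi).2
    exact sub_pos.2 (lt_of_lt_of_le (not_le.1 hj) (hmax j))
  have hafter := h.follows.mono fun ω hω t (ht : N ≤ t) => hω.after_init hε hG hmax hmin ht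
  have hmeas : ∀ (S : Finset (Fin K)) t, MeasurableSet {ω | π t ω ∈ S} := fun S t =>
    ((h.bandit.choice_measurable t).mono (ℱ.le t) le_rfl) (Finset.measurableSet S)
  have hgapint : ∀ t, Integrable (fun ω => gap μ imax (π t ω)) P := fun t =>
    Integrable.of_bound (((Measurable.of_discrete (f := gap μ imax)).comp
      ((h.bandit.choice_measurable t).mono (ℱ.le t) le_rfl)).aestronglyMeasurable) g
      (ae_of_all _ fun ω => by
        rw [Real.norm_of_nonneg (hgap0 _)]; exact hgap _)
  -- suboptimal arms of the top class, each compared with the best arm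
  have harm : ∀ i ∈ suboptTop ε μ imax,
      ∑ t ∈ Finset.Ico N T, P.real {ω | π t ω ∈ ({i} : Finset (Fin K))} ≤
        32 / gap μ imax i ^ 2 * Real.log T + 9 := by
    intro i hi
    refine h.bandit.sum_measureReal_le hν (S := {imax}) (S' := {i}) (lo := μ imax) (hi := μ i)
      (by simp [hμ]) (by simp [hμ]) (sub_pos.1 (hsub_pos i hi)) hN1 ?_ T
    filter_upwards [hafter] with ω hω t ht hmem
    obtain ⟨-, h1, h2, -⟩ := hω t ht
    have hti : π t ω = i := Finset.mem_singleton.1 hmem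
    refine ⟨h1 _ (Finset.mem_singleton_self _), ?_⟩
    rw [← armIndex_eq_classIndex, ← armIndex_eq_classIndex]
    have := h2 (hti ▸ hsubA hi)
    simpa only [hti] using this
  -- the bottom class, compared with the top class as a whole
  have hclass : ∑ t ∈ Finset.Ico N T, P.real {ω | π t ω ∈ Z \ A} ≤
      32 / d ^ 2 * Real.log T + 9 := by
    rcases complete_or_separated (ε := ε) hε hmax hmin with hc | hs
    · have : Z \ A = ∅ := Finset.sdiff_eq_empty_iff_subset.2 fun j _ => hc imax j
      rw [this]
      simp only [Finset.notMem_empty, Set.ofPred_false, measureReal_empty, Finset.sum_const_zero]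
      positivity
    · have hlt := maxGap_lt_minGap hs
      have hdd : μ imax - maxGap ε μ imax imax - (μ imax - minGap ε μ imax imin) = d := by
        rw [hd]; ring
      have := h.bandit.sum_measureReal_le hν (S := A) (S' := Z)
        (lo := μ imax - maxGap ε μ imax imax) (hi := μ imax - minGap ε μ imax imin)
        (fun j hj => by have := gap_le_maxGap (imax := imax) hj; rw [gap] at this; linarith)
        (fun j hj => by have := minGap_le_gap (imax := imax) hj; rw [gap] at this; linarith)
        (by linarith) hN1 (by
          filter_upwards [hafter] with ω hω t ht hmem
          obtain ⟨-, h1, -, h3⟩ := hω t ht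
          exact ⟨h1 _ (self_mem_eqClass _ _), h3 hmem⟩) T
      rw [hdd] at this
      refine (Finset.sum_le_sum fun t _ => measureReal_mono ?_ (measure_ne_top _ _)).trans this
      exact fun ω (hω : π t ω ∈ Z \ A) => (Finset.mem_sdiff.1 hω).1
  have hround : ∀ t ∈ Finset.Ico N T, ∫ ω, gap μ imax (π t ω) ∂P ≤
      ∑ i ∈ suboptTop ε μ imax, gap μ imax i * P.real {ω | π t ω ∈ ({i} : Finset (Fin K))} +
        g * P.real {ω | π t ω ∈ Z \ A} := by
    intro t ht
    have hind : ∀ S : Finset (Fin K),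
        Integrable ({ω | π t ω ∈ S}.indicator fun _ => (1 : ℝ)) P := fun S =>
      (integrable_const _).indicator (hmeas S t)
    have hI : ∀ S : Finset (Fin K), P.real {ω | π t ω ∈ S} =
        ∫ ω, {ω | π t ω ∈ S}.indicator (fun _ => (1 : ℝ)) ω ∂P := fun S => by
      rw [integral_indicator_const _ (hmeas S t), smul_eq_mul, mul_one]
    simp only [hI, ← integral_const_mul]
    rw [← integral_finsetSum _ fun i _ => (hind {i}).const_mul _,
      ← integral_add (integrable_finsetSum _ fun i _ => (hind {i}).const_mul _)
        ((hind _).const_mul _)]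
    refine integral_mono_ae (hgapint t) ((integrable_finsetSum _ fun i _ =>
      (hind {i}).const_mul _).add ((hind _).const_mul _)) ?_
    filter_upwards [hafter] with ω hω
    obtain ⟨hmem, -⟩ := hω t (Finset.mem_Ico.1 ht).1
    have hnn : 0 ≤ ∑ i ∈ suboptTop ε μ imax, gap μ imax i *
        {ω | π t ω ∈ ({i} : Finset (Fin K))}.indicator (fun _ => (1 : ℝ)) ω :=
      Finset.sum_nonneg fun i _ => mul_nonneg (hgap0 i)
        (Set.indicator_nonneg (fun _ _ => zero_le_one) _)
    have hnn' : 0 ≤ g * {ω | π t ω ∈ Z \ A}.indicator (fun _ => (1 : ℝ)) ω :=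
      mul_nonneg hg0 (Set.indicator_nonneg (fun _ _ => zero_le_one) _)
    by_cases hmA : π t ω ∈ A
    · by_cases hopt : ∀ j, μ j ≤ μ (π t ω)
      · have : gap μ imax (π t ω) ≤ 0 := sub_nonpos.2 (hopt imax)
        linarith
      · have hsub : π t ω ∈ suboptTop ε μ imax := Finset.mem_filter.2 ⟨hmA, hopt⟩
        have := Finset.single_le_sum (f := fun i => gap μ imax i *
          {ω | π t ω ∈ ({i} : Finset (Fin K))}.indicator (fun _ => (1 : ℝ)) ω)
          (fun i _ => mul_nonneg (hgap0 i) (Set.indicator_nonneg (fun _ _ => zero_le_one) _)) hsub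
        simp only [Set.indicator_apply, Set.mem_ofPred_eq, Finset.mem_singleton, if_true,
          mul_one] at this hnn' ⊢
        linarith
    · have hmZ : π t ω ∈ Z \ A :=
        Finset.mem_sdiff.2 ⟨(Finset.mem_union.1 hmem).resolve_left hmA, hmA⟩
      rw [Set.indicator_of_mem (s := {ω | π t ω ∈ Z \ A}) hmZ, mul_one]
      linarith [hgap (π t ω)]
  have hinit : ∑ t ∈ Finset.range N, ∫ ω, gap μ imax (π t ω) ∂P ≤ N * g := by
    rw [← nsmul_eq_mul]
    refine (Finset.sum_le_card_nsmul _ _ g fun t _ => ?_).trans (by rw [Finset.card_range])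
    exact (integral_mono (hgapint t) (integrable_const g) fun ω => hgap _).trans (by simp)
  have hsplit : ∑ t ∈ Finset.range T, ∫ ω, gap μ imax (π t ω) ∂P ≤
      ∑ t ∈ Finset.range N, ∫ ω, gap μ imax (π t ω) ∂P +
        ∑ t ∈ Finset.Ico N T, ∫ ω, gap μ imax (π t ω) ∂P := by
    rw [← Finset.sum_union (by
      rw [Finset.disjoint_left]
      intro t h1 h2
      exact absurd (Finset.mem_range.1 h1) (not_lt.2 (Finset.mem_Ico.1 h2).1))]
    refine Finset.sum_le_sum_of_subset_of_nonneg (fun t ht => ?_)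
      fun t _ _ => integral_nonneg fun ω => hgap0 _
    rw [Finset.mem_union, Finset.mem_range, Finset.mem_Ico]
    have := Finset.mem_range.1 ht
    omega
  have hlater : ∑ t ∈ Finset.Ico N T, ∫ ω, gap μ imax (π t ω) ∂P ≤
      ∑ i ∈ suboptTop ε μ imax, (32 / gap μ imax i * Real.log T + 9 * g) +
        g * (32 / d ^ 2 * Real.log T + 9) := by
    refine (Finset.sum_le_sum hround).trans ?_
    rw [Finset.sum_add_distrib, ← Finset.mul_sum, Finset.sum_comm]
    refine add_le_add (Finset.sum_le_sum fun i hi => ?_) (mul_le_mul_of_nonneg_left hclass hg0)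
    rw [← Finset.mul_sum]
    refine (mul_le_mul_of_nonneg_left (harm i hi) (hgap0 i)).trans ?_
    have hne := (hsub_pos i hi).ne'
    have e : gap μ imax i * (32 / gap μ imax i ^ 2 * Real.log T) =
        32 / gap μ imax i * Real.log T := by field_simp
    rw [mul_add, e]
    linarith [hgap i]
  rw [h.bandit.regret_eq hν]
  have hc1 : (N : ℝ) ≤ (candidateSet ε μ).card := by exact_mod_cast Finset.card_le_card hcand
  have hc2 : ((suboptTop ε μ imax).card : ℝ) ≤ N := by
    exact_mod_cast Finset.card_le_card (hsubA.trans Finset.subset_union_left)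
  have hc3 : (1 : ℝ) ≤ N := by exact_mod_cast hN1
  rw [Finset.sum_add_distrib, ← Finset.sum_mul, Finset.sum_const, nsmul_eq_mul] at hlater
  have k1 := mul_le_mul_of_nonneg_right hc1 hg0
  have k2 := mul_le_mul_of_nonneg_right hc2 hg0
  have k3 := mul_le_mul_of_nonneg_right hc3 hg0
  have e : 32 * g / d ^ 2 = g * (32 / d ^ 2) := by ring
  rw [e]
  linarith

end Regret

end UnitIntervalBandit

theorem theorem2 :
    (∃ C : ℝ, 0 ≤ C ∧
      ∀ (K : ℕ) (ε : ℝ) (ν : Fin K → Measure ℝ) (imax imin : Fin K)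
        (Ω : Type*) (m : MeasurableSpace Ω) (P : Measure Ω) (ℱ : Filtration ℕ m)
        (X : ℕ → Fin K → Ω → ℝ) (π : ℕ → Ω → Fin K),
        0 < ε →
        (∀ i, IsProbabilityMeasure (ν i)) →
        (∀ i, HasSubgaussianMGF (fun x => x - mean ν i) 1 (ν i)) →
        (uig ε (mean ν)).Connected →
        (∀ i, mean ν i ≤ mean ν imax) →
        (∀ i, mean ν imin ≤ mean ν i) →
        IsProbabilityMeasure P →
        IsLSDTCSI ε ν P ℱ X π →
        ((∃ i, 0 < gap (mean ν) imax i) →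
          minGap ε (mean ν) imax imin - maxGap ε (mean ν) imax imax ≠ 0) ∧
        ∀ T : ℕ,
          regret ν P X π imax T ≤
            (32 * maxGap ε (mean ν) imax imin
                / (minGap ε (mean ν) imax imin - maxGap ε (mean ν) imax imax) ^ 2
              + ∑ i ∈ suboptTop ε (mean ν) imax, 32 / gap (mean ν) imax i) * Real.log T
            + C * maxGap ε (mean ν) imax imin * ((candidateSet ε (mean ν)).card : ℝ)) ∧
    (∀ δ D : ℝ, 0 < δ → 0 < D → ∃ C : ℝ, 0 ≤ C ∧
      ∀ (K : ℕ) (ε : ℝ) (ν : Fin K → Measure ℝ) (imax imin : Fin K)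
        (Ω : Type*) (m : MeasurableSpace Ω) (P : Measure Ω) (ℱ : Filtration ℕ m)
        (X : ℕ → Fin K → Ω → ℝ) (π : ℕ → Ω → Fin K),
        0 < ε →
        (∀ i, IsProbabilityMeasure (ν i)) →
        (∀ i, HasSubgaussianMGF (fun x => x - mean ν i) 1 (ν i)) →
        (uig ε (mean ν)).Connected →
        (∀ i, mean ν i ≤ mean ν imax) →
        (∀ i, mean ν imin ≤ mean ν i) →
        IsProbabilityMeasure P →
        IsLSDTCSI ε ν P ℱ X π →
        (∀ i, gap (mean ν) imax i ≤ D) →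
        (∀ i ∈ suboptTop ε (mean ν) imax, δ ≤ gap (mean ν) imax i) →
        ((∃ i, 0 < gap (mean ν) imax i) →
          δ ≤ |minGap ε (mean ν) imax imin - maxGap ε (mean ν) imax imax|) →
        ∀ᶠ T : ℕ in atTop,
          regret ν P X π imax T ≤
            C * (1 + ((suboptTop ε (mean ν) imax).card : ℝ)) * Real.log T) := by

  refine ⟨⟨19, by norm_num, ?_⟩, fun δ D hδ hD => ⟨32 * D / δ ^ 2 + 32 / δ + 1, by positivity, ?_⟩⟩
  · intro K ε ν imax imin Ω m P ℱ X π hε hprob hν hG hmax hmin hP h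
    exact ⟨minGap_sub_maxGap_ne_zero hε hmax hmin, h.regret_le hε hν hG hmax hmin⟩
  · intro K ε ν imax imin Ω m P ℱ X π hε hprob hν hG hmax hmin hP h hgD hgδ hsep
    set g := maxGap ε (mean ν) imax imin
    set d := minGap ε (mean ν) imax imin - maxGap ε (mean ν) imax imax
    set n : ℝ := ((suboptTop ε (mean ν) imax).card : ℝ) with hn
    have hn0 : 0 ≤ n := Nat.cast_nonneg _
    have hgle : g ≤ D := Finset.sup'_le _ _ fun i _ => hgD i
    -- if all means agree, then `d = 0`, but the numerator vanishes as well
    have hfirst : 32 * g / d ^ 2 ≤ 32 * D / δ ^ 2 := by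
      by_cases hpos : ∃ i, 0 < gap (mean ν) imax i
      · have h1 : δ ^ 2 ≤ d ^ 2 := by
          rw [← sq_abs d]
          exact pow_le_pow_left₀ hδ.le (hsep hpos) 2
        have h2 : 0 < d ^ 2 := lt_of_lt_of_le (by positivity) h1
        gcongr
      · have h1 : g ≤ 0 :=
          Finset.sup'_le _ _ fun i _ => not_lt.1 fun hi => hpos ⟨i, hi⟩
        calc 32 * g / d ^ 2 ≤ 0 := div_nonpos_of_nonpos_of_nonneg (by linarith) (sq_nonneg d)
          _ ≤ _ := by positivity
    have hsum : ∑ i ∈ suboptTop ε (mean ν) imax, 32 / gap (mean ν) imax i ≤ n * (32 / δ) := by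
      rw [hn, ← nsmul_eq_mul]
      refine Finset.sum_le_card_nsmul _ _ _ fun i hi => ?_
      have := hgδ i hi
      gcongr
    have hlim := (Real.tendsto_log_atTop.comp tendsto_natCast_atTop_atTop).eventually_ge_atTop
      (19 * g * ((candidateSet ε (mean ν)).card : ℝ))
    filter_upwards [hlim] with T hT
    have hL : 0 ≤ Real.log T := Real.log_natCast_nonneg T
    refine (h.regret_le hε hν hG hmax hmin T).trans ?_
    have hcoef : 32 * g / d ^ 2 + ∑ i ∈ suboptTop ε (mean ν) imax, 32 / gap (mean ν) imax i + 1 ≤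
        (32 * D / δ ^ 2 + 32 / δ + 1) * (1 + n) := by
      have h1 : 0 ≤ 32 * D / δ ^ 2 * n := by positivity
      have h2 : 0 ≤ 32 / δ := by positivity
      linarith
    have := mul_le_mul_of_nonneg_right hcoef hL
    simp only [Function.comp_apply] at hT
    linarith
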